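/- Let $\mu$ be a $\sigma$-finite Borel measure on $\mathbb{R}$ that is $1$-periodic, i.e. $\mu(B+1)=\mu(B)$ for every Borel set $B\subseteq\mathbb{R}$. Let $n\in\mathbb{N}$, $\varphi\in[0,1)$, $a=(a_1,\dots,a_n)\in\mathbb{C}^n$, and consider the $1$-periodic trigonometric polynomial $$\psi(s)=e^{2\pi i\varphi}\sum_{k=1}^{n}a_k e^{-2\pi i ks},\qquad s\in\mathbb{R}.$$ Then, for all $\delta\in(0,1]$, $$\int_{[0,1)}|\psi(s)|^2\,\mathrm{d}\mu(s)\le\Bigl(n-1+\frac1\delta\Bigr)\,\sup_{r\in[0,1)}\mu\bigl((r,r+\delta)\bigr)\,\|a\|_2^2,$$ where $\|a\|_2^2=\sum_{k=1}^n|a_k|^2$. Both sides are elements of $[0,\infty]$, with the convention $0\cdot\infty=0$. -/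

import Mathlib

open MeasureTheory
open scoped ENNReal

/-- The trigonometric polynomial `ψ(s) = e^{2πiφ} ∑_{k=1}^n a_k e^{-2πiks}`. The coordinates of `a`
are indexed by `0, …, n-1`, so the coordinate `a k` carries the frequency `k + 1`. -/
noncomputable def trigPoly {n : ℕ} (φ : ℝ) (a : EuclideanSpace ℂ (Fin n)) (s : ℝ) : ℂ :=
  Complex.exp (2 * Real.pi * Complex.I * φ) *
    ∑ k : Fin n, a k * Complex.exp (-(2 * Real.pi * Complex.I * ((k : ℕ) + 1 : ℂ) * s))

/-- A Borel measure on `ℝ` is 1-periodic if it is invariant under translation by 1. -/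
def IsOnePeriodicMeasure (μ : Measure ℝ) : Prop :=
  ∀ B : Set ℝ, MeasurableSet B → μ ((fun x : ℝ => x + 1) '' B) = μ B

open scoped FourierTransform

/-!
Selberg's proof of the sharp large sieve, with translates at the scale `δ / N` in place of extremal
functions on the line.

Interpolating the sawtooth function from above at the points `j / N` of the circle gives a
trigonometric polynomial of degree `N - 1` whose mean exceeds that of the sawtooth by `1 / (2 N)`.
Adding a translate and a reflection of it to the constant `β` gives a majorant, of mean `β + 1 / N`,
of the indicator function of an arc of length `β`. By the Fejér–Riesz theorem this majorant is
`|∑ j < N, q j e^{2πi j x}|²`, and `∑ |q j|²` is its mean.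

Let `η = δ / N` and let the arc contain `k η` for every frequency `k`, so that its length is
`β = (n - 1) η`. Then the multiplier `∑ j, q j e^{-2πi j k η}` has modulus at least one at every
frequency. Dividing the coefficients of `ψ` by it gives `ψ_c`, with no larger coefficients, such
that `ψ(s) = ∑ j, q j ψ_c(s - j η)`. By the Cauchy–Schwarz inequality,
`|ψ(s)|² ≤ (β + 1 / N) ∑ j, |ψ_c(s - j η)|²`. Averaging over shifts of `s` in `(0, η)` turns the
right-hand side into `(n - 1 + 1 / δ) ∫ |ψ_c(s - t)|² dt` over `t ∈ (0, δ)`. Integrated against `μ`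
over a period, this is the average of `|ψ_c(t)|² μ((t, t + δ))`, which Parseval's identity bounds.
As `N → ∞` the averages of `|ψ|²` converge to `|ψ|²`, and Fatou's lemma applies.
-/

section Characters

open scoped ComplexConjugate Real

theorem fourierChar_eq_one_iff {x : ℝ} : 𝐞 x = 1 ↔ ∃ m : ℤ, x = m := by
  rw [Real.fourierChar_apply', Circle.exp_eq_one]
  refine exists_congr fun m => ?_
  rw [mul_comm (2 * π)]
  exact mul_left_inj' Real.two_pi_pos.ne'

theorem coe_fourierChar_intCast (m : ℤ) : (𝐞 (m : ℝ) : ℂ) = 1 := by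
  simp [fourierChar_eq_one_iff.2 ⟨m, rfl⟩]

theorem coe_fourierChar_add (x y : ℝ) : (𝐞 (x + y) : ℂ) = 𝐞 x * 𝐞 y := by
  rw [AddChar.map_add_eq_mul, Circle.coe_mul]

theorem conj_fourierChar (x : ℝ) : conj (𝐞 x : ℂ) = 𝐞 (-x) := by
  rw [AddChar.map_neg_eq_inv, Circle.coe_inv_eq_conj]

theorem coe_fourierChar_natCast_mul (k : ℕ) (x : ℝ) : (𝐞 (k * x) : ℂ) = 𝐞 x ^ k := by
  rw [← nsmul_eq_mul, AddChar.map_nsmul_eq_pow, Circle.coe_pow]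

theorem im_fourierChar (x : ℝ) : (𝐞 x : ℂ).im = Real.sin (2 * π * x) := by
  rw [Real.fourierChar_apply, Complex.exp_ofReal_mul_I_im]

theorem norm_fourierChar_sub_one (x : ℝ) : ‖(𝐞 x : ℂ) - 1‖ = 2 * |Real.sin (π * x)| := by
  rw [Real.fourierChar_apply, mul_comm, Complex.norm_exp_I_mul_ofReal_sub_one, norm_mul,
    Real.norm_ofNat, Real.norm_eq_abs, mul_assoc, mul_div_cancel_left₀ _ two_ne_zero]

@[fun_prop]
theorem continuous_coe_fourierChar : Continuous fun x : ℝ => (𝐞 x : ℂ) :=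
  Continuous.comp (by fun_prop : Continuous ((↑) : Circle → ℂ)) Real.continuous_fourierChar

theorem integral_fourierChar_intCast_mul (m : ℤ) :
    ∫ x in (0 : ℝ)..1, (𝐞 (m * x) : ℂ) = if m = 0 then 1 else 0 := by
  split_ifs with h
  · simp [h]
  · have hc : (2 * π * m * Complex.I : ℂ) ≠ 0 := by
      simp [h, Real.pi_ne_zero, Complex.I_ne_zero]
    have hexp (x : ℝ) : (𝐞 (m * x) : ℂ) = Complex.exp ((2 * π * m * Complex.I) * x) := by
      rw [Real.fourierChar_apply]; congr 1; push_cast; ring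
    simp_rw [hexp]
    rw [integral_exp_mul_complex hc, ← hexp, ← hexp, mul_one, mul_zero, coe_fourierChar_intCast]
    simp

theorem sum_fourierChar_intCast_mul_sub_div {N : ℕ} {m : ℤ} (hm : ¬ (N : ℤ) ∣ m) (x : ℝ) :
    ∑ j ∈ Finset.range N, (𝐞 (m * (x - j / N)) : ℂ) = 0 := by
  rcases N.eq_zero_or_pos with rfl | hN
  · simp
  have hgeom (j : ℕ) : (𝐞 (m * (x - j / N)) : ℂ) = 𝐞 (m * x) * 𝐞 (-(m / N : ℝ)) ^ j := by
    rw [← coe_fourierChar_natCast_mul, ← coe_fourierChar_add]; congr 2; ring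
  have hne : (𝐞 (-(m / N : ℝ)) : ℂ) ≠ 1 := by
    rw [Ne, Circle.coe_eq_one, fourierChar_eq_one_iff]
    rintro ⟨k, hk⟩
    refine hm ⟨-k, ?_⟩
    have : (m : ℝ) = N * -k := by rw [← hk]; field_simp
    exact_mod_cast this
  have hpow : (N : ℝ) * -(m / N) = (-m : ℤ) := by push_cast; field_simp
  simp_rw [hgeom]
  rw [← Finset.mul_sum, geom_sum_eq hne, ← coe_fourierChar_natCast_mul, hpow,
    coe_fourierChar_intCast]
  simp

/-- The exponential sum `∑ i, a i e^{2πi m i x}` with integral frequencies `m`. -/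
noncomputable def expSum {ι : Type*} [Fintype ι] (m : ι → ℤ) (a : ι → ℂ) (x : ℝ) : ℂ :=
  ∑ i, a i * 𝐞 (m i * x)

variable {ι : Type*} [Fintype ι] {m : ι → ℤ} {a : ι → ℂ}

@[fun_prop]
theorem continuous_expSum : Continuous (expSum m a) := by
  unfold expSum; fun_prop

theorem periodic_expSum : Function.Periodic (expSum m a) 1 := fun x => by
  simp only [expSum, mul_add, mul_one, coe_fourierChar_add, coe_fourierChar_intCast]

theorem ofReal_norm_expSum_sq (x : ℝ) : ((‖expSum m a x‖ ^ 2 : ℝ) : ℂ) =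
    ∑ i, ∑ j, a i * conj (a j) * 𝐞 ((m i - m j : ℤ) * x) := by
  rw [← Complex.normSq_eq_norm_sq, ← Complex.mul_conj, expSum, map_sum, Finset.sum_mul_sum]
  refine Finset.sum_congr rfl fun i _ => Finset.sum_congr rfl fun j _ => ?_
  rw [map_mul (starRingEnd ℂ), conj_fourierChar, Int.cast_sub, sub_mul, sub_eq_add_neg,
    coe_fourierChar_add]
  ring

theorem integral_norm_expSum_sq (hm : Function.Injective m) :
    ∫ x in (0 : ℝ)..1, ‖expSum m a x‖ ^ 2 = ∑ i, ‖a i‖ ^ 2 := by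
  classical
  apply Complex.ofReal_injective
  rw [← intervalIntegral.integral_ofReal, Complex.ofReal_sum]
  simp_rw [ofReal_norm_expSum_sq]
  rw [intervalIntegral.integral_finsetSum fun i _ =>
    (by fun_prop : Continuous _).intervalIntegrable _ _]
  refine Finset.sum_congr rfl fun i _ => ?_
  rw [intervalIntegral.integral_finsetSum fun i _ =>
    (by fun_prop : Continuous _).intervalIntegrable _ _]
  simp_rw [intervalIntegral.integral_const_mul, integral_fourierChar_intCast_mul, sub_eq_zero,
    hm.eq_iff]
  simp [Complex.mul_conj, Complex.normSq_eq_norm_sq]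

theorem sum_norm_expSum_sub_div_sq {N : ℕ} (hm : ∀ i j, (N : ℤ) ∣ m i - m j → i = j) (x : ℝ) :
    ∑ j ∈ Finset.range N, ‖expSum m a (x - j / N)‖ ^ 2 = N * ∑ i, ‖a i‖ ^ 2 := by
  classical
  have horth (i k : ι) : ∑ j ∈ Finset.range N, (𝐞 ((m i - m k : ℤ) * (x - j / N)) : ℂ) =
      if i = k then (N : ℂ) else 0 := by
    split_ifs with h
    · simp [h]
    · exact sum_fourierChar_intCast_mul_sub_div (fun hdvd => h (hm i k hdvd)) x
  apply Complex.ofReal_injective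
  rw [Complex.ofReal_sum]
  simp_rw [ofReal_norm_expSum_sq]
  rw [Finset.sum_comm]
  simp_rw [Finset.sum_comm (s := Finset.range N), ← Finset.mul_sum, horth]
  simp [Complex.mul_conj, Complex.normSq_eq_norm_sq, Finset.mul_sum, mul_comm]

end Characters

section SawtoothMajorant

open Set
open scoped Real

theorem mul_cos_le_sin {t : ℝ} (h0 : 0 ≤ t) (hπ : t ≤ π) : t * Real.cos t ≤ Real.sin t := by
  rcases le_or_gt (Real.cos t) 0 with h | h
  · exact (mul_nonpos_of_nonneg_of_nonpos h0 h).trans (Real.sin_nonneg_of_nonneg_of_le_pi h0 hπ)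
  · have ht : t < π / 2 := lt_of_not_ge fun h2 =>
      h.not_ge (Real.cos_nonpos_of_pi_div_two_le_of_le h2 (by linarith))
    have := Real.le_tan h0 ht
    rwa [Real.tan_eq_sin_div_cos, le_div_iff₀ h] at this

theorem cot_le_inv {t : ℝ} (ht : t ∈ Ioo 0 π) : Real.cot t ≤ t⁻¹ := by
  rw [Real.cot_eq_cos_div_sin, div_le_iff₀ (Real.sin_pos_of_mem_Ioo ht), inv_mul_eq_div,
    le_div_iff₀ ht.1, mul_comm]
  exact mul_cos_le_sin ht.1.le ht.2.le

theorem hasDerivAt_cot {t : ℝ} (ht : Real.sin t ≠ 0) :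
    HasDerivAt Real.cot (-(Real.sin t ^ 2)⁻¹) t := by
  have h := (Real.hasDerivAt_cos t).div (Real.hasDerivAt_sin t) ht
  have hval : (-Real.sin t * Real.sin t - Real.cos t * Real.cos t) / Real.sin t ^ 2 =
      -(Real.sin t ^ 2)⁻¹ := by
    field_simp
    linear_combination -Real.sin_sq_add_cos_sq t
  rw [hval] at h
  exact h.congr_of_eventuallyEq (.of_forall Real.cot_eq_cos_div_sin)

theorem inv_neg_sub_cot_neg (t : ℝ) : (-t)⁻¹ - Real.cot (-t) = -(t⁻¹ - Real.cot t) := by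
  rw [Real.cot_eq_cos_div_sin, Real.cot_eq_cos_div_sin, Real.cos_neg, Real.sin_neg, inv_neg,
    div_neg, neg_sub_neg, neg_sub]

theorem monotoneOn_inv_sub_cot_Ioo_zero_pi :
    MonotoneOn (fun t : ℝ => t⁻¹ - Real.cot t) (Ioo 0 π) := by
  have hderiv (t : ℝ) (ht : t ∈ Ioo 0 π) :
      HasDerivAt (fun t : ℝ => t⁻¹ - Real.cot t) (-(t ^ 2)⁻¹ - -(Real.sin t ^ 2)⁻¹) t :=
    (hasDerivAt_inv ht.1.ne').sub (hasDerivAt_cot (Real.sin_pos_of_mem_Ioo ht).ne')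
  refine monotoneOn_of_hasDerivWithinAt_nonneg (convex_Ioo _ _)
    (fun t ht => (hderiv t ht).continuousAt.continuousWithinAt)
    (fun t ht => (hderiv t (interior_subset ht)).hasDerivWithinAt) fun t ht => ?_
  replace ht := interior_subset ht
  have hsin := Real.sin_pos_of_mem_Ioo ht
  have hsin_le := Real.sin_le ht.1.le
  rw [sub_neg_eq_add, neg_add_eq_sub, sub_nonneg]
  gcongr

/-- At `0`, where `t⁻¹` and `cot t` are junk, the difference has its limiting value `0`. -/
theorem monotoneOn_inv_sub_cot : MonotoneOn (fun t : ℝ => t⁻¹ - Real.cot t) (Ioo (-π) π) := by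
  have hnonneg {t : ℝ} (h0 : 0 ≤ t) (hπ : t < π) : 0 ≤ t⁻¹ - Real.cot t := by
    rcases h0.eq_or_lt with rfl | h0
    · simp [Real.cot_eq_cos_div_sin]
    · exact sub_nonneg.2 (cot_le_inv ⟨h0, hπ⟩)
  have hnonpos {t : ℝ} (h0 : t ≤ 0) (hπ : -π < t) : t⁻¹ - Real.cot t ≤ 0 := by
    have := hnonneg (neg_nonneg.2 h0) (neg_lt.1 hπ)
    rwa [inv_neg_sub_cot_neg, neg_nonneg] at this
  intro s hs t ht hst
  rcases lt_or_ge 0 s with hs0 | hs0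
  · exact monotoneOn_inv_sub_cot_Ioo_zero_pi ⟨hs0, hs.2⟩ ⟨hs0.trans_le hst, ht.2⟩ hst
  rcases lt_or_ge t 0 with ht0 | ht0
  · have := monotoneOn_inv_sub_cot_Ioo_zero_pi (a := -t) (b := -s) ⟨neg_pos.2 ht0, neg_lt.1 ht.1⟩
      ⟨by linarith, neg_lt.1 hs.1⟩ (neg_le_neg hst)
    simp only [inv_neg_sub_cot_neg] at this
    exact neg_le_neg_iff.1 this
  · exact (hnonpos hs0 hs.1).trans (hnonneg ht0 ht.2)

theorem inv_sub_cot_add_div_sin_nonneg {s t : ℝ} (hs : s ∈ Ioo (-π) π) (ht : t ∈ Ioo (-π) π)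
    (hst : s + t ∈ Ioo (-π) π) :
    0 ≤ (s⁻¹ - Real.cot s + (t⁻¹ - Real.cot t)) / Real.sin (s + t) := by
  have hs' : -s ∈ Ioo (-π) π := ⟨neg_lt_neg hs.2, neg_lt.1 hs.1⟩
  rcases lt_trichotomy (s + t) 0 with h | h | h
  · have hmono := monotoneOn_inv_sub_cot ht hs' (by linarith)
    simp only [inv_neg_sub_cot_neg] at hmono
    exact div_nonneg_of_nonpos (by linarith) (Real.sin_neg_of_neg_of_neg_pi_lt h hst.1).le
  · simp [h]
  · have hmono := monotoneOn_inv_sub_cot hs' ht (by linarith)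
    simp only [inv_neg_sub_cot_neg] at hmono
    exact div_nonneg (by linarith) (Real.sin_pos_of_mem_Ioo ⟨h, hst.2⟩).le

theorem sin_ne_zero_of_mem_Ioo {t : ℝ} (ht : t ∈ Ioo (-π) π) (h0 : t ≠ 0) : Real.sin t ≠ 0 :=
  (Real.sin_eq_zero_iff_of_lt_of_lt ht.1 ht.2).not.2 h0

/-- The tangent line inequality, for increments to the right, of the convex function `-t cot t`,
whose derivative is `t / sin² t - cot t`. -/
theorem mul_div_sin_sq_sub_cot_le {t d : ℝ} (ht : t ∈ Ioo (-π) π) (hd : d ∈ Ioo 0 π)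
    (htd : t + d ∈ Ioo (-π) π) (ht0 : t ≠ 0) (htd0 : t + d ≠ 0) :
    d * (t / Real.sin t ^ 2 - Real.cot t) ≤ t * Real.cot t - (t + d) * Real.cot (t + d) := by
  have hsin_t := sin_ne_zero_of_mem_Ioo ht ht0
  have hsin_td := sin_ne_zero_of_mem_Ioo htd htd0
  have hsin_d := Real.sin_pos_of_mem_Ioo hd
  have hd0 := hd.1
  have hpos : 0 ≤ t * Real.sin t := by
    rcases ht0.lt_or_gt with h | h
    · exact (mul_pos_of_neg_of_neg h (Real.sin_neg_of_neg_of_neg_pi_lt h ht.1)).le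
    · exact (mul_pos h (Real.sin_pos_of_mem_Ioo ⟨h, ht.2⟩)).le
  have hnonneg := mul_nonneg (mul_nonneg (inv_sub_cot_add_div_sin_nonneg ht
    ⟨(neg_lt_zero.2 Real.pi_pos).trans hd0, hd.2⟩ htd) hpos)
    (div_nonneg (mul_pos hd0 hsin_d).le (sq_nonneg (Real.sin t)))
  have hnum : (t⁻¹ - Real.cot t + (d⁻¹ - Real.cot d)) * (t * Real.sin t) * (d * Real.sin d) =
      (t + d) * Real.sin t * Real.sin d - t * d * Real.sin (t + d) := by
    rw [Real.sin_add, Real.cot_eq_cos_div_sin, Real.cot_eq_cos_div_sin]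
    field_simp
    ring
  have hsub : Real.sin d = Real.sin (t + d) * Real.cos t - Real.cos (t + d) * Real.sin t := by
    rw [← Real.sin_sub, add_sub_cancel_left]
  have hgap : t * Real.cot t - (t + d) * Real.cot (t + d) - d * (t / Real.sin t ^ 2 - Real.cot t) =
      ((t + d) * Real.sin t * Real.sin d - t * d * Real.sin (t + d)) /
        (Real.sin (t + d) * Real.sin t ^ 2) := by
    simp only [Real.cot_eq_cos_div_sin]
    field_simp
    linear_combination (-(t + d) * Real.sin t) * hsub
  rw [← sub_nonneg, hgap, ← hnum]
  exact hnonneg.trans_eq (by ring)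

/-- The Fejér kernel of degree `N - 1`, normalised to the value `1` at `0`. -/
noncomputable def fejer (N : ℕ) (x : ℝ) : ℝ :=
  ‖expSum (fun k : Fin N => (k : ℤ)) 1 x‖ ^ 2 / N ^ 2

/-- The conjugate Dirichlet kernel of degree `N - 1`. -/
noncomputable def conjDirichlet (N : ℕ) (x : ℝ) : ℝ :=
  ∑ k ∈ Finset.range N, Real.sin (2 * π * (k * x))

/-- A trigonometric polynomial of degree `N - 1` and mean `1 / (2 N)` that majorises the sawtooth
function `x - ⌊x⌋ - 1 / 2`, obtained by interpolating its value from the left, and one-sided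
derivatives, at the points `(j + 1) / N`. -/
noncomputable def sawMajorant (N : ℕ) (x : ℝ) : ℝ :=
  ∑ j ∈ Finset.range N, ((j + 1) / N - 1 / 2) * fejer N (x - (j + 1) / N) -
    conjDirichlet N x / (π * N)

@[fun_prop]
theorem continuous_fejer (N : ℕ) : Continuous (fejer N) := by
  unfold fejer; fun_prop

@[fun_prop]
theorem continuous_conjDirichlet (N : ℕ) : Continuous (conjDirichlet N) := by
  unfold conjDirichlet; fun_prop

@[fun_prop]
theorem continuous_sawMajorant (N : ℕ) : Continuous (sawMajorant N) := by
  unfold sawMajorant; fun_prop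

variable {N : ℕ}

theorem fejer_eq_sin_sq_div {x : ℝ} (hx : Real.sin (π * x) ≠ 0) :
    fejer N x = Real.sin (π * (N * x)) ^ 2 / (N ^ 2 * Real.sin (π * x) ^ 2) := by
  have hne : (𝐞 x : ℂ) ≠ 1 := fun h => hx <| by simpa [h] using norm_fourierChar_sub_one x
  have hgeom : expSum (fun k : Fin N => (k : ℤ)) 1 x = (𝐞 (N * x) - 1) / (𝐞 x - 1) := by
    simp only [expSum, Pi.one_apply, one_mul, Int.cast_natCast, coe_fourierChar_natCast_mul]
    rw [Fin.sum_univ_eq_sum_range (fun k => (𝐞 x : ℂ) ^ k), geom_sum_eq hne]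
  rw [fejer, hgeom, norm_div, norm_fourierChar_sub_one, norm_fourierChar_sub_one, div_pow, mul_pow,
    mul_pow, sq_abs, sq_abs, mul_div_mul_left _ _ (by norm_num), div_div, mul_comm ((N : ℝ) ^ 2)]

theorem conjDirichlet_mul_sin (N : ℕ) (x : ℝ) :
    conjDirichlet N x * Real.sin (π * x) =
      Real.sin (π * (N * x)) ^ 2 * Real.cos (π * x) -
      Real.sin (π * (N * x)) * Real.cos (π * (N * x)) * Real.sin (π * x) := by
  induction N with
  | zero => simp [conjDirichlet]
  | succ N ih =>
    have hdouble : 2 * π * (N * x) = 2 * (π * (N * x)) := by ring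
    have hsucc : π * ((N + 1 : ℕ) * x) = π * (N * x) + π * x := by push_cast; ring
    rw [conjDirichlet, Finset.sum_range_succ, ← conjDirichlet, add_mul, ih, hdouble, hsucc,
      Real.sin_two_mul, Real.sin_add, Real.cos_add]
    linear_combination (-Real.sin (π * (N * x)) * Real.cos (π * (N * x)) * Real.sin (π * x) -
      Real.sin (π * (N * x)) ^ 2 * Real.cos (π * x)) * Real.sin_sq_add_cos_sq (π * x)

theorem conjDirichlet_eq_mul_cot_sub {x : ℝ} (hx : Real.sin (π * x) ≠ 0) :
    conjDirichlet N x = Real.sin (π * (N * x)) ^ 2 * Real.cot (π * x) -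
      Real.sin (π * (N * x)) * Real.cos (π * (N * x)) := by
  rw [Real.cot_eq_cos_div_sin, mul_div_assoc', eq_sub_iff_add_eq, eq_div_iff hx]
  linear_combination conjDirichlet_mul_sin N x

theorem sum_fejer_sub_div (hN : N ≠ 0) (x : ℝ) :
    ∑ j ∈ Finset.range N, fejer N (x - j / N) = 1 := by
  have hinj (i j : Fin N) (h : (N : ℤ) ∣ (i : ℤ) - (j : ℤ)) : i = j := by
    have := Int.eq_zero_of_abs_lt_dvd h (by rw [abs_lt]; omega)
    omega
  simp only [fejer]
  rw [← Finset.sum_div, sum_norm_expSum_sub_div_sq hinj]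
  simp [← sq, hN]

theorem sum_conjDirichlet_sub_div (N : ℕ) (x : ℝ) :
    ∑ j ∈ Finset.range N, conjDirichlet N (x - j / N) = 0 := by
  simp_rw [conjDirichlet]
  rw [Finset.sum_comm]
  refine Finset.sum_eq_zero fun k hk => ?_
  rcases k.eq_zero_or_pos with rfl | hk0
  · simp
  have hdvd : ¬ (N : ℤ) ∣ (k : ℤ) := fun h =>
    (Nat.le_of_dvd hk0 (Int.natCast_dvd_natCast.1 h)).not_gt (Finset.mem_range.1 hk)
  simpa [im_fourierChar] using congr_arg Complex.im (sum_fourierChar_intCast_mul_sub_div hdvd x)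

theorem sin_mul_sub_div_sq (hN : N ≠ 0) (x : ℝ) (j : ℕ) :
    Real.sin (π * (N * (x - j / N))) ^ 2 = Real.sin (π * (N * x)) ^ 2 := by
  have harg : π * (N * (x - j / N)) = π * (N * x) - j * π := by field_simp
  rw [harg, Real.sin_sub_nat_mul_pi, mul_pow, ← pow_mul, Even.neg_one_pow ⟨j, by ring⟩, one_mul]

theorem sin_mul_cos_mul_sub_div (hN : N ≠ 0) (x : ℝ) (j : ℕ) :
    Real.sin (π * (N * (x - j / N))) * Real.cos (π * (N * (x - j / N))) =
      Real.sin (π * (N * x)) * Real.cos (π * (N * x)) := by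
  have harg : π * (N * (x - j / N)) = π * (N * x) - j * π := by field_simp
  rw [harg, Real.sin_sub_nat_mul_pi, Real.cos_sub_nat_mul_pi, mul_mul_mul_comm, ← mul_pow,
    neg_one_mul, neg_neg, one_pow, one_mul]

theorem sum_mul_fejer_sub_div (hN : N ≠ 0) {x : ℝ}
    (hx : ∀ j : ℕ, Real.sin (π * (x - j / N)) ≠ 0) :
    ∑ j ∈ Finset.range N, ((j + 1) / N - 1 / 2) * fejer N (x - (j + 1) / N) =
      x - 1 / 2 - Real.sin (π * (N * x)) * Real.cos (π * (N * x)) / (π * N) -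
        Real.sin (π * (N * x)) ^ 2 / (π * N ^ 2) * ∑ j ∈ Finset.range N,
          (π * (x - (j + 1) / N) / Real.sin (π * (x - (j + 1) / N)) ^ 2 -
            Real.cot (π * (x - (j + 1) / N))) := by
  set w := Real.sin (π * (N * x)) ^ 2 with hw
  set c := Real.sin (π * (N * x)) * Real.cos (π * (N * x)) with hc
  have hterm (j : ℕ) : ((j + 1) / N - 1 / 2) * fejer N (x - (j + 1) / N) =
      (x - 1 / 2) * fejer N (x - 1 / N - j / N)
        - (π * N ^ 2)⁻¹ * conjDirichlet N (x - 1 / N - j / N) - c / (π * N ^ 2) -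
        w / (π * N ^ 2) * (π * (x - (j + 1) / N) / Real.sin (π * (x - (j + 1) / N)) ^ 2 -
            Real.cot (π * (x - (j + 1) / N))) := by
    have hsin := hx (j + 1)
    have hsq := sin_mul_sub_div_sq hN x (j + 1)
    have hsc := sin_mul_cos_mul_sub_div hN x (j + 1)
    have hnode : x - 1 / N - j / N = x - (j + 1) / N := by ring
    have hpt : ((j : ℝ) + 1) / N - 1 / 2 = x - 1 / 2 - (x - (j + 1) / N) := by ring
    push_cast at hsin hsq hsc
    rw [hnode, conjDirichlet_eq_mul_cot_sub hsin, fejer_eq_sin_sq_div hsin, hsq, hsc, hpt,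
      ← hw, ← hc]
    generalize x - ((j : ℝ) + 1) / N = u at hsin ⊢
    field_simp
    ring
  rw [Finset.sum_congr rfl fun j _ => hterm j]
  simp only [Finset.sum_sub_distrib, ← Finset.mul_sum, sum_fejer_sub_div hN,
    sum_conjDirichlet_sub_div, Finset.sum_const, Finset.card_range, nsmul_eq_mul]
  field_simp
  ring

theorem sawMajorant_sub_eq (hN : N ≠ 0) {x : ℝ} (hx : ∀ j : ℕ, Real.sin (π * (x - j / N)) ≠ 0) :
    sawMajorant N x - (x - 1 / 2) = Real.sin (π * (N * x)) ^ 2 / (π ^ 2 * N) *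
      ∑ j ∈ Finset.range N,
        (π * (x - (j + 1) / N) * Real.cot (π * (x - (j + 1) / N)) -
          π * (x - j / N) * Real.cot (π * (x - j / N)) -
          π / N * (π * (x - (j + 1) / N) / Real.sin (π * (x - (j + 1) / N)) ^ 2 -
            Real.cot (π * (x - (j + 1) / N)))) := by
  have hx0 : Real.sin (π * x) ≠ 0 := by simpa using hx 0
  have hN' : (N : ℝ) ≠ 0 := by exact_mod_cast hN
  have hcot : Real.cot (π * (x - 1)) = Real.cot (π * x) := by
    rw [Real.cot_eq_cos_div_sin, mul_sub_one, Real.sin_sub_pi, Real.cos_sub_pi, neg_div_neg_eq,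
      Real.cot_eq_cos_div_sin]
  have htelescope := Finset.sum_range_sub
    (fun j : ℕ => π * (x - j / N) * Real.cot (π * (x - j / N))) N
  rw [div_self hN', hcot, Nat.cast_zero, zero_div, sub_zero] at htelescope
  push_cast at htelescope
  rw [Finset.sum_sub_distrib, htelescope, ← Finset.mul_sum, sawMajorant,
    sum_mul_fejer_sub_div hN hx, conjDirichlet_eq_mul_cot_sub hx0]
  generalize ∑ j ∈ Finset.range N, (_ : ℝ) = A
  generalize Real.cot (π * x) = c
  generalize Real.sin (π * (N * x)) = s
  generalize Real.cos (π * (N * x)) = t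
  field_simp
  ring

theorem le_sawMajorant_of_forall_ne (hN : 2 ≤ N) {x : ℝ} (hx : x ∈ Ioo 0 1)
    (hne : ∀ m : ℤ, x ≠ m / N) : x - 1 / 2 ≤ sawMajorant N x := by
  have hN1 : (1 : ℝ) < N := by exact_mod_cast hN
  have hN0 : (N : ℝ) ≠ 0 := by positivity
  have hπ := Real.pi_pos
  have hne_int (j : ℕ) (m : ℤ) : x - j / N ≠ m := fun h => hne (j + m * N) <| by
    rw [sub_eq_iff_eq_add] at h
    rw [h]; push_cast; field_simp; ring
  have hsin (j : ℕ) : Real.sin (π * (x - j / N)) ≠ 0 := by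
    rw [Real.sin_ne_zero_iff]
    intro m hm
    exact hne_int j m (mul_left_cancel₀ hπ.ne' (by rw [← hm, mul_comm]))
  have hθ0 (j : ℕ) : π * (x - j / N) ≠ 0 :=
    mul_ne_zero hπ.ne' (by simpa using hne_int j 0)
  have hθ {j : ℕ} (hj : j ≤ N) : π * (x - j / N) ∈ Ioo (-π) π := by
    have h0 : 0 ≤ (j : ℝ) / N := by positivity
    have h1 : (j : ℝ) / N ≤ 1 := div_le_one_of_le₀ (by exact_mod_cast hj) (by positivity)
    constructor <;> nlinarith [hx.1, hx.2]
  rw [← sub_nonneg, sawMajorant_sub_eq (by omega) hsin]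
  refine mul_nonneg (by positivity) (Finset.sum_nonneg fun j hj => ?_)
  have hj := Finset.mem_range.1 hj
  have hsucc : π * (x - (j + 1 : ℕ) / N) + π / N = π * (x - j / N) := by push_cast; ring
  have htangent := mul_div_sin_sq_sub_cot_le (hθ hj) ⟨div_pos hπ (by linarith), div_lt_self hπ hN1⟩
    (hsucc ▸ hθ hj.le) (hθ0 _) (hsucc ▸ hθ0 j)
  rw [hsucc] at htangent
  push_cast at htangent
  exact sub_nonneg.2 htangent

theorem le_sawMajorant (hN : 2 ≤ N) {x : ℝ} (hx : x ∈ Icc (0 : ℝ) 1) :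
    x - 1 / 2 ≤ sawMajorant N x := by
  have hdense : Dense (range fun m : ℤ => (m / N : ℝ))ᶜ := (countable_range _).dense_compl ℝ
  have hsubset : Icc (0 : ℝ) 1 ⊆ closure (Ioo 0 1 ∩ (range fun m : ℤ => (m / N : ℝ))ᶜ) := by
    rw [← closure_Ioo zero_ne_one]
    exact closure_minimal (hdense.open_subset_closure_inter isOpen_Ioo) isClosed_closure
  refine le_on_closure (f := fun x => x - 1 / 2) (g := sawMajorant N) (fun y hy => ?_)
    (by fun_prop) (by fun_prop) (hsubset hx)
  exact le_sawMajorant_of_forall_ne hN hy.1 fun m hm => hy.2 ⟨m, hm.symm⟩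

end SawtoothMajorant

section FejerRiesz

open Polynomial ComplexConjugate ComplexOrder Topology

theorem neBot_nhdsNE_circle (z : Circle) : (𝓝[≠] z).NeBot := by
  have : Nontrivial Circle := ⟨1, Circle.exp Real.pi, fun h => by
    have : (1 : ℂ) = -1 := by simpa using congr_arg ((↑) : Circle → ℂ) h
    norm_num at this⟩
  infer_instance

theorem eq_of_forall_circle_eval_eq {p q : ℂ[X]}
    (h : ∀ z : Circle, p.eval (z : ℂ) = q.eval (z : ℂ)) :
    p = q := by
  have := neBot_nhdsNE_circle 1
  have : Infinite Circle :=
    Set.infinite_univ_iff.1 (infinite_of_mem_nhds (1 : Circle) Filter.univ_mem)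
  refine eq_of_infinite_eval_eq p q
    ((Set.infinite_range_of_injective (α := Circle) Circle.coe_injective).mono ?_)
  rintro _ ⟨z, rfl⟩
  exact h z

theorem eval_reflect_map_conj {p : ℂ[X]} {N : ℕ} (hdeg : p.natDegree ≤ N) {z : ℂ} (hz : z ≠ 0) :
    (reflect N (p.map (starRingEnd ℂ))).eval z = z ^ N * conj (p.eval (conj z)⁻¹) := by
  let : Invertible z⁻¹ := invertibleOfNonzero (inv_ne_zero hz)
  have h := eval₂_reflect_mul_pow (RingHom.id ℂ) z⁻¹ N (p.map (starRingEnd ℂ))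
    (by simpa using hdeg)
  have hconj : z⁻¹ = conj (conj z)⁻¹ := by simp
  simp only [invOf_eq_inv, inv_inv, eval₂_id, inv_pow, ← div_eq_mul_inv] at h
  rw [div_eq_iff (pow_ne_zero N hz)] at h
  rw [h, hconj, eval_map, eval₂_hom, mul_comm]

variable {d : ℕ} {p : ℂ[X]}

theorem eq_reflect_map_conj_of_im_eq_zero (hdeg : p.natDegree ≤ 2 * d)
    (hp : ∀ z : Circle, (p.eval (z : ℂ) / z ^ d).im = 0) :
    p = reflect (2 * d) (p.map (starRingEnd ℂ)) := by
  refine eq_of_forall_circle_eval_eq fun z => ?_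
  have hreal := Complex.conj_eq_iff_im.2 (hp z)
  have hz := z.coe_ne_zero
  rw [eval_reflect_map_conj hdeg hz, ← Circle.coe_inv_eq_conj, Circle.coe_inv, inv_inv]
  rw [map_div₀, map_pow, ← Circle.coe_inv_eq_conj, Circle.coe_inv] at hreal
  rw [inv_pow, div_inv_eq_mul, eq_div_iff (pow_ne_zero d hz)] at hreal
  linear_combination -hreal

theorem eval_inv_conj_eq_zero (hdeg : p.natDegree ≤ 2 * d)
    (hp : ∀ z : Circle, (p.eval (z : ℂ) / z ^ d).im = 0) {w : ℂ} (hw0 : w ≠ 0)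
    (hw : p.eval w = 0) : p.eval (conj w)⁻¹ = 0 := by
  rw [eq_reflect_map_conj_of_im_eq_zero hdeg hp, eval_reflect_map_conj hdeg hw0] at hw
  simpa [hw0] using hw

/-- A zero of a nonnegative function is a minimum, so the derivative vanishes there. -/
theorem sq_X_sub_C_dvd_of_nonneg (hp : ∀ z : Circle, 0 ≤ p.eval (z : ℂ) / z ^ d) {w : Circle}
    (hw : p.eval (w : ℂ) = 0) : (X - C (w : ℂ)) ^ 2 ∣ p := by
  by_cases hp0 : p = 0
  · simp [hp0]
  suffices hd : p.derivative.eval (w : ℂ) = 0 from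
    (pow_dvd_pow _ ((one_lt_rootMultiplicity_iff_isRoot hp0).2 ⟨hw, hd⟩)).trans
      (pow_rootMultiplicity_dvd p w)
  let γ : ℝ → Circle := fun t => w * Circle.exp t
  have hγ0 : γ 0 = w := by simp [γ]
  have hγ : HasDerivAt (fun t => (γ t : ℂ)) (w * Complex.I) 0 := by
    have := ((Complex.ofRealCLM.hasDerivAt (x := 0)).mul_const Complex.I).cexp.const_mul (w : ℂ)
    simpa [γ] using this
  set f : ℝ → ℂ := fun t => p.eval (γ t : ℂ) / γ t ^ d
  obtain ⟨D, hD, hD0⟩ : ∃ D, HasDerivAt f D 0 ∧ (D = 0 → p.derivative.eval (w : ℂ) = 0) := by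
    have h := (HasDerivAt.comp (0 : ℝ) (p.hasDerivAt (γ 0 : ℂ)) hγ).div (hγ.pow d)
      (pow_ne_zero _ (γ 0).coe_ne_zero)
    refine ⟨_, h, ?_⟩
    simp [hγ0, hw]
  have hre : D.re = 0 := by
    refine IsLocalMin.hasDerivAt_eq_zero (Filter.Eventually.of_forall fun t => ?_)
      (Complex.reCLM.hasFDerivAt.comp_hasDerivAt (0 : ℝ) hD)
    simpa [f, hγ0, hw] using (Complex.nonneg_iff.1 (hp (γ t))).1
  have him : D.im = 0 := by
    refine (Complex.imCLM.hasFDerivAt.comp_hasDerivAt (0 : ℝ) hD).unique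
      ((hasDerivAt_const (0 : ℝ) (0 : ℝ)).congr_of_eventuallyEq
        (Filter.Eventually.of_forall fun t => ?_))
    exact (Complex.nonneg_iff.1 (hp (γ t))).2.symm
  exact hD0 (Complex.ext hre him)

theorem X_sub_C_mul_X_sub_C_inv_conj_dvd (hdeg : p.natDegree ≤ 2 * d)
    (hp : ∀ z : Circle, 0 ≤ p.eval (z : ℂ) / z ^ d) {w : ℂ} (hw0 : w ≠ 0) (hw : p.eval w = 0) :
    (X - C w) * (X - C (conj w)⁻¹) ∣ p := by
  by_cases hww : w = (conj w)⁻¹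
  · obtain ⟨z, rfl⟩ : ∃ z : Circle, (z : ℂ) = w := by
      refine ⟨⟨w, mem_sphere_zero_iff_norm.2 ?_⟩, rfl⟩
      have := congr_arg norm ((mul_eq_one_iff_eq_inv₀ ((_root_.map_ne_zero _).2 hw0)).2 hww)
      rw [norm_mul, Complex.norm_conj, norm_one] at this
      nlinarith [norm_nonneg w]
    rw [← hww, ← sq]
    exact sq_X_sub_C_dvd_of_nonneg hp hw
  · refine (isCoprime_X_sub_C_of_isUnit_sub (sub_ne_zero.2 hww).isUnit).mul_dvd
      (dvd_iff_isRoot.2 hw) (dvd_iff_isRoot.2 ?_)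
    exact eval_inv_conj_eq_zero hdeg (fun z => (Complex.nonneg_iff.1 (hp z)).2.symm) hw0 hw

/-- On the circle, `(z - w) (z - (conj w)⁻¹) / z = -(conj w)⁻¹ ‖z - w‖²`. -/
theorem exists_eval_div_pow_eq_norm_sub_sq_mul (hdeg : p.natDegree ≤ 2 * (d + 1))
    (hp : ∀ z : Circle, 0 ≤ p.eval (z : ℂ) / z ^ (d + 1)) {w : ℂ} (hw0 : w ≠ 0)
    (hw : p.eval w = 0) :
    ∃ q : ℂ[X], q.natDegree ≤ 2 * d ∧ ∀ z : Circle,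
      p.eval (z : ℂ) / z ^ (d + 1) = ((‖(z : ℂ) - w‖ ^ 2 : ℝ) : ℂ) * (q.eval (z : ℂ) / z ^ d) := by
  obtain ⟨p₂, rfl⟩ := X_sub_C_mul_X_sub_C_inv_conj_dvd hdeg hp hw0 hw
  refine ⟨C (-(conj w)⁻¹) * p₂, (natDegree_C_mul_le _ _).trans ?_, fun z => ?_⟩
  · by_cases h0 : p₂ = 0
    · simp [h0]
    · have hm : ((X - C w) * (X - C (conj w)⁻¹)).Monic := (monic_X_sub_C w).mul (monic_X_sub_C _)
      rw [hm.natDegree_mul' h0, (monic_X_sub_C w).natDegree_mul (monic_X_sub_C _),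
        natDegree_X_sub_C, natDegree_X_sub_C] at hdeg
      omega
  · have hz := z.coe_ne_zero
    have hnorm : ((‖(z : ℂ) - w‖ ^ 2 : ℝ) : ℂ) = (z - w) * ((z : ℂ)⁻¹ - conj w) := by
      rw [← Circle.coe_inv, Circle.coe_inv_eq_conj, ← map_sub, Complex.mul_conj,
        Complex.normSq_eq_norm_sq]
    have hcw : conj w ≠ 0 := (_root_.map_ne_zero _).2 hw0
    rw [hnorm]
    simp only [eval_mul, eval_sub, eval_X, eval_C]
    field_simp
    ring

theorem nonneg_of_nonneg_norm_sub_sq_mul {f : Circle → ℂ} (hf : Continuous f) {w : ℂ}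
    (h : ∀ z : Circle, 0 ≤ ((‖(z : ℂ) - w‖ ^ 2 : ℝ) : ℂ) * f z) (z : Circle) : 0 ≤ f z := by
  have hne (z : Circle) (hz : (z : ℂ) ≠ w) : 0 ≤ f z := by
    have hpos : 0 < ‖(z : ℂ) - w‖ ^ 2 := pow_pos (norm_pos_iff.2 (sub_ne_zero.2 hz)) 2
    have hinv : (0 : ℂ) ≤ ((‖(z : ℂ) - w‖ ^ 2)⁻¹ : ℝ) := by exact_mod_cast (inv_pos.2 hpos).le
    have := mul_nonneg hinv (h z)
    rwa [← mul_assoc, ← Complex.ofReal_mul, inv_mul_cancel₀ hpos.ne', Complex.ofReal_one,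
      one_mul] at this
  by_cases hz : (z : ℂ) = w
  · have := neBot_nhdsNE_circle z
    refine ge_of_tendsto (hf.continuousWithinAt (s := {z}ᶜ) (x := z)) ?_
    filter_upwards [self_mem_nhdsWithin] with y hy
    exact hne y fun hyw => hy (Circle.coe_injective (hyw.trans hz.symm))
  · exact hne z hz

theorem coeff_two_mul_eq_conj_coeff_zero (hdeg : p.natDegree ≤ 2 * d)
    (hp : ∀ z : Circle, (p.eval (z : ℂ) / z ^ d).im = 0) :
    p.coeff (2 * d) = conj (p.coeff 0) := by
  conv_lhs => rw [eq_reflect_map_conj_of_im_eq_zero hdeg hp]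
  rw [coeff_reflect, revAt_le le_rfl, Nat.sub_self, coeff_map]

theorem exists_eval_div_pow_succ_eq_norm_sq_mul (hdeg : p.natDegree ≤ 2 * (d + 1))
    (hp : ∀ z : Circle, 0 ≤ p.eval (z : ℂ) / z ^ (d + 1)) :
    ∃ l q : ℂ[X], l.natDegree ≤ 1 ∧ q.natDegree ≤ 2 * d ∧
      (∀ z : Circle, 0 ≤ q.eval (z : ℂ) / z ^ d) ∧ ∀ z : Circle,
      p.eval (z : ℂ) / z ^ (d + 1) =
        ((‖l.eval (z : ℂ)‖ ^ 2 : ℝ) : ℂ) * (q.eval (z : ℂ) / z ^ d) := by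
  have htop := coeff_two_mul_eq_conj_coeff_zero hdeg
    fun z => (Complex.nonneg_iff.1 (hp z)).2.symm
  by_cases h0 : p.coeff 0 = 0
  · obtain ⟨q, rfl⟩ := X_dvd_iff.2 h0
    have hq (z : Circle) : (X * q).eval (z : ℂ) / z ^ (d + 1) = q.eval (z : ℂ) / z ^ d := by
      rw [eval_mul, eval_X, pow_succ', mul_div_mul_left _ _ z.coe_ne_zero]
    refine ⟨1, q, by simp, ?_, fun z => hq z ▸ hp z, fun z => by rw [hq]; simp⟩
    rw [natDegree_le_iff_coeff_eq_zero]
    intro k hk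
    rw [← coeff_X_mul]
    rcases (show 2 * d + 2 ≤ k + 1 by omega).eq_or_lt with hk | hk
    · rw [← hk, ← mul_add_one, htop, h0, map_zero]
    · exact coeff_eq_zero_of_natDegree_lt (by omega)
  · have hdegree : p.degree ≠ 0 := fun hdegree => h0 <| by
      have hlt : p.natDegree < 2 * (d + 1) := by
        rw [natDegree_eq_zero_iff_degree_le_zero.2 hdegree.le]; omega
      rw [coeff_eq_zero_of_natDegree_lt hlt] at htop
      exact (_root_.map_eq_zero _).1 htop.symm
    obtain ⟨w, hw⟩ := IsAlgClosed.exists_root p hdegree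
    have hw0 : w ≠ 0 := by
      rintro rfl
      exact h0 (by rwa [coeff_zero_eq_eval_zero])
    obtain ⟨q, hq_deg, hq⟩ := exists_eval_div_pow_eq_norm_sub_sq_mul hdeg hp hw0 hw
    refine ⟨X - C w, q, by simp, hq_deg, ?_, by simpa using hq⟩
    refine nonneg_of_nonneg_norm_sub_sq_mul ?_ fun z => hq z ▸ hp z
    exact (by fun_prop : Continuous fun z : Circle => q.eval (z : ℂ)).div₀ (by fun_prop)
      fun z => pow_ne_zero _ z.coe_ne_zero

theorem exists_eval_div_pow_eq_norm_sq (hdeg : p.natDegree ≤ 2 * d)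
    (hp : ∀ z : Circle, 0 ≤ p.eval (z : ℂ) / z ^ d) :
    ∃ q : ℂ[X], q.natDegree ≤ d ∧
      ∀ z : Circle, p.eval (z : ℂ) / z ^ d = ((‖q.eval (z : ℂ)‖ ^ 2 : ℝ) : ℂ) := by
  induction d generalizing p with
  | zero =>
    obtain ⟨c, rfl⟩ : ∃ c, p = C c := ⟨_, eq_C_of_natDegree_le_zero hdeg⟩
    have hc : 0 ≤ c := by simpa using hp 1
    lift c to ℝ using (Complex.nonneg_iff.1 hc).2.symm
    exact ⟨C ((√c : ℝ) : ℂ), by simp, fun z => by simp [Real.sq_sqrt (Complex.zero_le_real.1 hc)]⟩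
  | succ d ih =>
    obtain ⟨l, p₂, hl, hdeg₂, hp₂, hfactor⟩ := exists_eval_div_pow_succ_eq_norm_sq_mul hdeg hp
    obtain ⟨q, hqdeg, hq⟩ := ih hdeg₂ hp₂
    refine ⟨l * q, natDegree_mul_le.trans (by omega), fun z => ?_⟩
    rw [hfactor, hq, eval_mul, norm_mul, mul_pow, Complex.ofReal_mul]

end FejerRiesz

section TrigSpace

open Set
open scoped Real

/-- The space of trigonometric polynomials of degree at most `d` and period `1`. -/
noncomputable def trigSpace (d : ℕ) : Submodule ℂ (ℝ → ℂ) :=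
  Submodule.span ℂ ((fun (k : ℤ) (x : ℝ) => (𝐞 (k * x) : ℂ)) '' {k | |k| ≤ d})

variable {d : ℕ} {f : ℝ → ℂ}

theorem fourierChar_intCast_mul_mem_trigSpace {k : ℤ} (hk : |k| ≤ d) :
    (fun x : ℝ => (𝐞 (k * x) : ℂ)) ∈ trigSpace d :=
  Submodule.subset_span ⟨k, hk, rfl⟩

theorem const_mem_trigSpace (d : ℕ) (c : ℂ) : (fun _ : ℝ => c) ∈ trigSpace d := by
  convert (trigSpace d).smul_mem c (fourierChar_intCast_mul_mem_trigSpace (k := 0) (by simp))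
    using 1
  ext; simp

theorem comp_sub_mem_trigSpace (hf : f ∈ trigSpace d) (c : ℝ) :
    (fun x => f (x - c)) ∈ trigSpace d := by
  suffices h : trigSpace d ≤ (trigSpace d).comap (LinearMap.funLeft ℂ ℂ (· - c)) from h hf
  refine Submodule.span_le.2 ?_
  rintro _ ⟨k, hk, rfl⟩
  rw [SetLike.mem_coe, Submodule.mem_comap]
  convert (trigSpace d).smul_mem (𝐞 (k * -c) : ℂ) (fourierChar_intCast_mul_mem_trigSpace hk)
    using 1
  ext x
  rw [LinearMap.funLeft_apply, Pi.smul_apply, smul_eq_mul, ← coe_fourierChar_add]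
  ring_nf

theorem comp_neg_mem_trigSpace (hf : f ∈ trigSpace d) : (fun x => f (-x)) ∈ trigSpace d := by
  suffices h : trigSpace d ≤ (trigSpace d).comap (LinearMap.funLeft ℂ ℂ (-·)) from h hf
  refine Submodule.span_le.2 ?_
  rintro _ ⟨k, hk, rfl⟩
  rw [SetLike.mem_coe, Submodule.mem_comap]
  convert fourierChar_intCast_mul_mem_trigSpace (k := -k) (d := d) (by rwa [abs_neg]) using 1
  ext x
  simp [LinearMap.funLeft_apply]

theorem periodic_of_mem_trigSpace (hf : f ∈ trigSpace d) : Function.Periodic f 1 := fun x => by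
  suffices h : trigSpace d ≤ LinearMap.eqLocus (LinearMap.proj (x + 1)) (LinearMap.proj x) from
    h hf
  refine Submodule.span_le.2 ?_
  rintro _ ⟨k, -, rfl⟩
  simp [mul_add, AddChar.map_add_eq_mul, coe_fourierChar_intCast]

open Polynomial in
theorem exists_polynomial_of_mem_trigSpace (hf : f ∈ trigSpace d) :
    ∃ p : ℂ[X], p.natDegree ≤ 2 * d ∧ ∀ x, f x = p.eval (𝐞 x : ℂ) / (𝐞 x : ℂ) ^ d := by
  induction hf using Submodule.span_induction with
  | mem _ h =>
    obtain ⟨k, hk, rfl⟩ := h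
    rw [mem_ofPred_eq, abs_le] at hk
    obtain ⟨m, hm⟩ := Int.eq_ofNat_of_zero_le (by omega : 0 ≤ k + d)
    refine ⟨X ^ m, by rw [natDegree_X_pow]; omega, fun x => ?_⟩
    have hk : (m * x : ℝ) = k * x + d * x := by
      rw [← add_mul, ← Int.cast_natCast m, ← hm]; push_cast; ring
    rw [eval_pow, eval_X, eq_div_iff (pow_ne_zero d (Circle.coe_ne_zero _)),
      ← coe_fourierChar_natCast_mul, ← coe_fourierChar_natCast_mul, hk, coe_fourierChar_add]
  | zero => exact ⟨0, by simp, by simp⟩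
  | add f g _ _ hf hg =>
    obtain ⟨p, hp_deg, hp⟩ := hf
    obtain ⟨q, hq_deg, hq⟩ := hg
    exact ⟨p + q, (natDegree_add_le _ _).trans (max_le hp_deg hq_deg), fun x => by
      rw [Pi.add_apply, hp, hq, eval_add, add_div]⟩
  | smul c f _ hf =>
    obtain ⟨p, hp_deg, hp⟩ := hf
    exact ⟨C c * p, (natDegree_C_mul_le _ _).trans hp_deg, fun x => by
      rw [Pi.smul_apply, hp, eval_mul, eval_C, smul_eq_mul, mul_div_assoc]⟩

theorem ofReal_fejer_mem_trigSpace (d : ℕ) : (fun x => (fejer (d + 1) x : ℂ)) ∈ trigSpace d := by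
  have hmem (k l : Fin (d + 1)) : (fun x : ℝ => (𝐞 ((k - l : ℤ) * x) : ℂ)) ∈ trigSpace d :=
    fourierChar_intCast_mul_mem_trigSpace (by rw [abs_le]; omega)
  convert (trigSpace d).smul_mem (((d + 1 : ℕ) ^ 2 : ℂ)⁻¹) (Submodule.sum_mem _
    fun k (_ : k ∈ Finset.univ) => Submodule.sum_mem _ fun l (_ : l ∈ Finset.univ) => hmem k l)
    using 1
  ext x
  rw [fejer, Complex.ofReal_div, ofReal_norm_expSum_sq, div_eq_inv_mul]
  simp

theorem ofReal_conjDirichlet_mem_trigSpace (d : ℕ) :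
    (fun x => (conjDirichlet (d + 1) x : ℂ)) ∈ trigSpace d := by
  have hmem (k : ℕ) (hk : k ∈ Finset.range (d + 1)) :
      (fun x : ℝ => (Real.sin (2 * π * (k * x)) : ℂ)) ∈ trigSpace d := by
    have hk := Finset.mem_range.1 hk
    convert (trigSpace d).smul_mem (2 * Complex.I)⁻¹ ((trigSpace d).sub_mem
      (fourierChar_intCast_mul_mem_trigSpace (k := k) (by rw [abs_le]; omega))
      (fourierChar_intCast_mul_mem_trigSpace (k := -k) (by rw [abs_le]; omega))) using 1
    ext x
    simp only [Pi.smul_apply, Pi.sub_apply, smul_eq_mul, Int.cast_neg, Int.cast_natCast, neg_mul]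
    rw [← im_fourierChar, Complex.im_eq_sub_conj, conj_fourierChar, div_eq_inv_mul]
  convert Submodule.sum_mem _ hmem using 1
  ext x
  simp [conjDirichlet]

theorem ofReal_sawMajorant_mem_trigSpace (d : ℕ) :
    (fun x => (sawMajorant (d + 1) x : ℂ)) ∈ trigSpace d := by
  convert (trigSpace d).sub_mem
    (Submodule.sum_mem _ fun (j : ℕ) (_ : j ∈ Finset.range (d + 1)) =>
      Submodule.smul_mem _ ((((j + 1) / (d + 1 : ℕ) - 1 / 2 : ℝ)) : ℂ)
        (comp_sub_mem_trigSpace (ofReal_fejer_mem_trigSpace d) ((j + 1) / (d + 1 : ℕ))))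
    ((trigSpace d).smul_mem (((π * (d + 1 : ℕ))⁻¹ : ℝ) : ℂ)
      (ofReal_conjDirichlet_mem_trigSpace d)) using 1
  ext x
  simp only [sawMajorant, Pi.sub_apply, Finset.sum_apply, Pi.smul_apply, smul_eq_mul,
    div_eq_inv_mul (conjDirichlet _ _), Complex.ofReal_sub, Complex.ofReal_sum, Complex.ofReal_mul]

theorem periodic_of_ofReal_mem_trigSpace {f : ℝ → ℝ} (hf : (fun x => (f x : ℂ)) ∈ trigSpace d) :
    Function.Periodic f 1 := fun x =>
  Complex.ofReal_injective (periodic_of_mem_trigSpace hf x)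

theorem exists_norm_expSum_sq_eq_of_nonneg {f : ℝ → ℝ} (hf : (fun x => (f x : ℂ)) ∈ trigSpace d)
    (hf0 : ∀ x, 0 ≤ f x) :
    ∃ c : Fin (d + 1) → ℂ, ∀ x, f x = ‖expSum (fun k : Fin (d + 1) => (k : ℤ)) c x‖ ^ 2 := by
  obtain ⟨p, hp_deg, hp⟩ := exists_polynomial_of_mem_trigSpace hf
  have hsurj (z : Circle) : ∃ x, 𝐞 x = z := by
    obtain ⟨t, rfl⟩ := Circle.exp_surjective z
    exact ⟨t / (2 * π), by rw [Real.fourierChar_apply', mul_div_cancel₀ _ Real.two_pi_pos.ne']⟩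
  obtain ⟨q, hq_deg, hq⟩ := exists_eval_div_pow_eq_norm_sq hp_deg fun z => by
    obtain ⟨x, rfl⟩ := hsurj z
    rw [← hp]
    exact Complex.zero_le_real.2 (hf0 x)
  refine ⟨fun k => q.coeff k, fun x => Complex.ofReal_injective ?_⟩
  rw [hp, hq, Polynomial.eval_eq_sum_range' (Nat.lt_succ_of_le hq_deg), expSum]
  simp only [Int.cast_natCast, coe_fourierChar_natCast_mul]
  rw [Fin.sum_univ_eq_sum_range fun k => q.coeff k * (𝐞 x : ℂ) ^ k]

end TrigSpace

section ArcMajorant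

open Set
open scoped Real

theorem intervalIntegral_comp_sub_of_periodic {f : ℝ → ℝ} (hf : Function.Periodic f 1) (c : ℝ) :
    ∫ x in (0 : ℝ)..1, f (x - c) = ∫ x in (0 : ℝ)..1, f x := by
  have h := hf.intervalIntegral_add_eq (0 - c) 0
  rwa [zero_add, sub_add_eq_add_sub, zero_add,
    ← intervalIntegral.integral_comp_sub_right (fun x => f x)] at h

theorem intervalIntegral_comp_neg_of_periodic {f : ℝ → ℝ} (hf : Function.Periodic f 1) :
    ∫ x in (0 : ℝ)..1, f (-x) = ∫ x in (0 : ℝ)..1, f x := by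
  have h := hf.intervalIntegral_add_eq (-1) 0
  rwa [zero_add, neg_add_cancel, ← neg_zero, ← intervalIntegral.integral_comp_neg, neg_zero] at h

variable {N : ℕ}

theorem integral_fejer (hN : N ≠ 0) : ∫ x in (0 : ℝ)..1, fejer N x = 1 / N := by
  have hN : (N : ℝ) ≠ 0 := by exact_mod_cast hN
  simp_rw [fejer]
  rw [intervalIntegral.integral_div,
    integral_norm_expSum_sq fun k l h => by simpa [Fin.ext_iff] using h]
  simp only [Pi.one_apply, norm_one, one_pow, Finset.sum_const, Finset.card_univ, Fintype.card_fin,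
    nsmul_eq_mul, mul_one]
  field_simp

theorem integral_conjDirichlet (N : ℕ) : ∫ x in (0 : ℝ)..1, conjDirichlet N x = 0 := by
  have hodd (x : ℝ) : conjDirichlet N (-x) = -conjDirichlet N x := by
    simp [conjDirichlet]
  have hper : Function.Periodic (conjDirichlet N) 1 := fun x => by
    refine Finset.sum_congr rfl fun k _ => ?_
    rw [← Real.sin_add_nat_mul_two_pi (2 * π * (k * x)) k]; ring_nf
  have h := intervalIntegral_comp_neg_of_periodic hper
  simp_rw [hodd] at h
  rw [intervalIntegral.integral_neg] at h
  linarith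

theorem sum_range_succ_div_sub_half (hN : N ≠ 0) :
    ∑ j ∈ Finset.range N, (((j : ℝ) + 1) / N - 1 / 2) = 1 / 2 := by
  have hN' : (N : ℝ) ≠ 0 := by exact_mod_cast hN
  have hgauss := congr_arg ((↑) : ℕ → ℝ) (Finset.sum_range_id_mul_two (N + 1))
  rw [Finset.sum_range_succ'] at hgauss
  push_cast at hgauss
  rw [Finset.sum_sub_distrib, ← Finset.sum_div, Finset.sum_const, Finset.card_range, nsmul_eq_mul]
  field_simp
  simp only [add_zero] at hgauss
  linarith

theorem periodic_sawMajorant (hN : N ≠ 0) : Function.Periodic (sawMajorant N) 1 := by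
  obtain ⟨d, rfl⟩ := Nat.exists_eq_succ_of_ne_zero hN
  exact periodic_of_ofReal_mem_trigSpace (ofReal_sawMajorant_mem_trigSpace d)

theorem integral_sawMajorant (hN : N ≠ 0) :
    ∫ x in (0 : ℝ)..1, sawMajorant N x = 1 / (2 * N) := by
  have hper : Function.Periodic (fejer N) 1 := fun x => by
    rw [fejer, periodic_expSum, fejer]
  simp_rw [sawMajorant]
  rw [intervalIntegral.integral_sub (Continuous.intervalIntegrable (by fun_prop) _ _)
    (Continuous.intervalIntegrable (by fun_prop) _ _),
    intervalIntegral.integral_finsetSum fun k _ =>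
      (Continuous.intervalIntegrable (by fun_prop) _ _),
    intervalIntegral.integral_div, integral_conjDirichlet]
  simp_rw [intervalIntegral.integral_const_mul, intervalIntegral_comp_sub_of_periodic hper,
    integral_fejer hN]
  rw [← Finset.sum_mul, sum_range_succ_div_sub_half hN]
  field_simp
  simp

/-- Selberg's majorant `x ↦ β + T (x - β) + T (-x)` of the indicator function of the arc `[0, β]` of
`ℝ / ℤ`, where `T` majorises the sawtooth function. -/
noncomputable def arcMajorant (N : ℕ) (β x : ℝ) : ℝ :=
  β + sawMajorant N (x - β) + sawMajorant N (-x)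

theorem ofReal_arcMajorant_mem_trigSpace (d : ℕ) (β : ℝ) :
    (fun x => (arcMajorant (d + 1) β x : ℂ)) ∈ trigSpace d := by
  have hT := ofReal_sawMajorant_mem_trigSpace d
  convert (trigSpace d).add_mem ((trigSpace d).add_mem (const_mem_trigSpace d β)
    (comp_sub_mem_trigSpace hT β)) (comp_neg_mem_trigSpace hT) using 1
  ext x
  simp [arcMajorant]

theorem half_sub_le_sawMajorant_neg (hN : 2 ≤ N) {x : ℝ} (hx : x ∈ Icc (0 : ℝ) 1) :
    1 / 2 - x ≤ sawMajorant N (-x) := by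
  have h := le_sawMajorant hN (x := -x + 1) ⟨by linarith [hx.2], by linarith [hx.1]⟩
  rw [periodic_sawMajorant (by omega)] at h
  linarith

theorem one_le_arcMajorant (hN : 2 ≤ N) {β x : ℝ} (hβ : β ≤ 1) (hx : x ∈ Icc 0 β) :
    1 ≤ arcMajorant N β x := by
  have h := half_sub_le_sawMajorant_neg hN (x := β - x) ⟨by linarith [hx.2], by linarith [hx.1]⟩
  have hneg := half_sub_le_sawMajorant_neg hN ⟨hx.1, hx.2.trans hβ⟩
  rw [neg_sub] at h
  rw [arcMajorant]
  linarith

theorem arcMajorant_nonneg (hN : 2 ≤ N) {β : ℝ} (hβ : β ∈ Icc (0 : ℝ) 1) (x : ℝ) :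
    0 ≤ arcMajorant N β x := by
  have hper : Function.Periodic (arcMajorant N β) 1 := by
    obtain ⟨d, rfl⟩ : ∃ d, N = d + 1 := ⟨N - 1, by omega⟩
    exact periodic_of_ofReal_mem_trigSpace (ofReal_arcMajorant_mem_trigSpace d β)
  rw [← hper.sub_int_mul_eq ⌊x⌋, mul_one, Int.self_sub_floor]
  have hx0 := Int.fract_nonneg x
  have hx1 := (Int.fract_lt_one x).le
  rcases le_or_gt (Int.fract x) β with h | h
  · exact zero_le_one.trans (one_le_arcMajorant hN hβ.2 ⟨hx0, h⟩)
  · have h := le_sawMajorant hN (x := Int.fract x - β) ⟨by linarith, by linarith [hβ.1]⟩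
    have hneg := half_sub_le_sawMajorant_neg hN ⟨hx0, hx1⟩
    rw [arcMajorant]
    linarith

theorem integral_arcMajorant (hN : N ≠ 0) (β : ℝ) :
    ∫ x in (0 : ℝ)..1, arcMajorant N β x = β + 1 / N := by
  have hper := periodic_sawMajorant hN
  simp_rw [arcMajorant]
  rw [intervalIntegral.integral_add (Continuous.intervalIntegrable (by fun_prop) _ _)
    (Continuous.intervalIntegrable (by fun_prop) _ _),
    intervalIntegral.integral_add (Continuous.intervalIntegrable (by fun_prop) _ _)
    (Continuous.intervalIntegrable (by fun_prop) _ _), intervalIntegral_comp_sub_of_periodic hper,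
    intervalIntegral_comp_neg_of_periodic hper, integral_sawMajorant hN,
    intervalIntegral.integral_const, sub_zero, one_smul]
  field_simp
  ring

/-- The square of the exponential sum is Selberg's majorant of the arc `[0, β]` of `ℝ / ℤ`. -/
theorem exists_one_le_norm_expSum_of_mem_Icc (hN : 2 ≤ N) {β : ℝ} (hβ : β ∈ Icc (0 : ℝ) 1) :
    ∃ c : Fin N → ℂ, (∀ x ∈ Icc 0 β, 1 ≤ ‖expSum (fun k : Fin N => (k : ℤ)) c x‖) ∧
      ∑ k, ‖c k‖ ^ 2 = β + 1 / N := by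
  obtain ⟨d, rfl⟩ : ∃ d, N = d + 1 := ⟨N - 1, by omega⟩
  obtain ⟨c, hc⟩ := exists_norm_expSum_sq_eq_of_nonneg (ofReal_arcMajorant_mem_trigSpace d β)
    (arcMajorant_nonneg hN hβ)
  refine ⟨c, fun x hx => ?_, ?_⟩
  · have h := one_le_arcMajorant hN hβ.2 hx
    rwa [hc, one_le_sq_iff₀ (norm_nonneg _)] at h
  · rw [← integral_norm_expSum_sq (m := fun k : Fin (d + 1) => (k : ℤ))
      fun k l h => by simpa [Fin.ext_iff] using h]
    simp_rw [← hc]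
    exact integral_arcMajorant d.succ_ne_zero β

end ArcMajorant

section PeriodicMeasure

open Set
open scoped Topology

theorem isOnePeriodicMeasure_volume : IsOnePeriodicMeasure (volume : Measure ℝ) := fun B _ => by
  rw [image_add_right, measure_preimage_add_right]

namespace IsOnePeriodicMeasure

variable {μ ν : Measure ℝ}

theorem measurePreserving_add_one (hμ : IsOnePeriodicMeasure μ) :
    MeasurePreserving (· + (1 : ℝ)) μ μ := by
  refine ⟨measurable_add_const 1, Measure.ext fun B hB => ?_⟩
  rw [Measure.map_apply (measurable_add_const 1) hB, ← hμ _ (hB.preimage (measurable_add_const 1)),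
    image_preimage_eq _ (add_right_surjective 1)]

theorem measurePreserving_add_intCast (hμ : IsOnePeriodicMeasure μ) (m : ℤ) :
    MeasurePreserving (· + (m : ℝ)) μ μ := by
  have h := hμ.measurePreserving_add_one
  induction m using Int.induction_on with
  | zero => simpa using! MeasurePreserving.id μ
  | succ m ih => simpa [Function.comp_def, add_assoc] using h.comp ih
  | pred m ih =>
    have hneg := h.symm (MeasurableEquiv.addRight (1 : ℝ))
    simpa [Function.comp_def, add_assoc, sub_eq_add_neg] using hneg.comp ih

theorem lintegral_eq_lintegral_Ico_tsum (hμ : IsOnePeriodicMeasure μ) {f : ℝ → ℝ≥0∞}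
    (hf : Measurable f) : ∫⁻ s, f s ∂μ = ∫⁻ s in Ico (0 : ℝ) 1, ∑' m : ℤ, f (s + m) ∂μ := by
  have htranslate (m : ℤ) : Measurable fun s : ℝ => f (s + m) := hf.comp (measurable_add_const _)
  rw [lintegral_tsum fun m => (htranslate m).aemeasurable,
    ← setLIntegral_univ, ← iUnion_Ico_intCast ℝ,
    lintegral_iUnion (fun _ => measurableSet_Ico) (pairwise_disjoint_Ico_intCast ℝ)]
  refine tsum_congr fun m => ?_
  rw [(hμ.measurePreserving_add_intCast m).setLIntegral_comp_emb (measurableEmbedding_addRight _),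
    image_add_const_Ico, zero_add, add_comm]

/-- Unfolding: both sides are the integral of `K` over the quotient of the plane by the diagonal
action of `ℤ`. -/
theorem lintegral_Ico_lintegral_swap (hμ : IsOnePeriodicMeasure μ) (hν : IsOnePeriodicMeasure ν)
    [SFinite μ] [SFinite ν] {K : ℝ → ℝ → ℝ≥0∞} (hK : Measurable (Function.uncurry K))
    (hper : ∀ (m : ℤ) s t, K (s + m) (t + m) = K s t) :
    ∫⁻ s in Ico (0 : ℝ) 1, ∫⁻ t, K s t ∂ν ∂μ = ∫⁻ t in Ico (0 : ℝ) 1, ∫⁻ s, K s t ∂μ ∂ν := by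
  have hKs (s : ℝ) : Measurable (K s) := hK.of_uncurry_left
  have hKt (t : ℝ) : Measurable fun s => K s t := hK.of_uncurry_right
  simp_rw [hν.lintegral_eq_lintegral_Ico_tsum (hKs _), hμ.lintegral_eq_lintegral_Ico_tsum (hKt _)]
  rw [lintegral_lintegral_swap (Measurable.tsum fun m =>
    hK.comp (measurable_fst.prodMk (measurable_snd.add_const _))).aemeasurable]
  refine lintegral_congr fun t => lintegral_congr fun s => ?_
  rw [← (Equiv.neg ℤ).tsum_eq]
  refine tsum_congr fun m => ?_
  rw [← hper m]
  simp

theorem measure_Ioo_le_iSup (hμ : IsOnePeriodicMeasure μ) (δ t : ℝ) :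
    μ (Ioo t (t + δ)) ≤ ⨆ r ∈ Ico (0 : ℝ) 1, μ (Ioo r (r + δ)) := by
  have h := (hμ.measurePreserving_add_intCast ⌊t⌋).measure_preimage_emb
    (measurableEmbedding_addRight _) (Ioo t (t + δ))
  rw [preimage_add_const_Ioo, add_sub_right_comm, Int.self_sub_floor] at h
  rw [← h]
  exact le_iSup₂ (f := fun r (_ : r ∈ Ico (0 : ℝ) 1) => μ (Ioo r (r + δ))) (Int.fract t)
    ⟨Int.fract_nonneg t, Int.fract_lt_one t⟩

theorem isLocallyFiniteMeasure (hμ : IsOnePeriodicMeasure μ) {δ : ℝ} (hδ : 0 < δ)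
    (hfin : (⨆ r ∈ Ico (0 : ℝ) 1, μ (Ioo r (r + δ))) ≠ ⊤) : IsLocallyFiniteMeasure μ where
  finiteAtNhds x := ⟨Ioo (x - δ / 2) (x - δ / 2 + δ),
    Ioo_mem_nhds (by linarith) (by linarith),
    (hμ.measure_Ioo_le_iSup δ _).trans_lt hfin.lt_top⟩

theorem lintegral_Ico_lintegral_Ioo_sub_le [SFinite μ] (hμ : IsOnePeriodicMeasure μ)
    {f : ℝ → ℝ≥0∞} (hf : Measurable f) (hper : Function.Periodic f 1) (δ : ℝ) :
    ∫⁻ s in Ico (0 : ℝ) 1, (∫⁻ t in Ioo 0 δ, f (s - t)) ∂μ ≤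
      (⨆ r ∈ Ico (0 : ℝ) 1, μ (Ioo r (r + δ))) * ∫⁻ t in Ico (0 : ℝ) 1, f t := by
  let K : ℝ → ℝ → ℝ≥0∞ := fun s t => (Ioo t (t + δ)).indicator (fun _ => f t) s
  have hK : Measurable (Function.uncurry K) :=
    (hf.comp measurable_snd).indicator (s := {x : ℝ × ℝ | x.1 ∈ Ioo x.2 (x.2 + δ)})
      ((measurableSet_lt measurable_snd measurable_fst).inter
        (measurableSet_lt measurable_fst (measurable_snd.add_const δ)))
  have hKper (m : ℤ) (s t : ℝ) : K (s + m) (t + m) = K s t := by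
    have hft : f (t + m) = f t := by simpa using hper.int_mul m t
    simp [K, indicator, hft, add_right_comm t (m : ℝ)]
  have hconv (s : ℝ) : ∫⁻ t in Ioo 0 δ, f (s - t) = ∫⁻ t, K s t := by
    rw [← lintegral_indicator measurableSet_Ioo, ← lintegral_sub_left_eq_self _ s]
    simp [K, indicator, sub_lt_iff_lt_add']
  have hinner (t : ℝ) : ∫⁻ s, K s t ∂μ = f t * μ (Ioo t (t + δ)) :=
    lintegral_indicator_const measurableSet_Ioo _
  simp_rw [hconv]
  rw [hμ.lintegral_Ico_lintegral_swap isOnePeriodicMeasure_volume hK hKper,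
    ← lintegral_const_mul _ hf]
  refine lintegral_mono fun t => ?_
  rw [hinner, mul_comm]
  exact mul_le_mul_left (hμ.measure_Ioo_le_iSup δ t) _

end IsOnePeriodicMeasure

end PeriodicMeasure

section LargeSieve

open Set Filter
open scoped Topology

theorem ofReal_norm_sq {E : Type*} [SeminormedAddCommGroup E] (z : E) :
    ENNReal.ofReal (‖z‖ ^ 2) = ‖z‖ₑ ^ 2 := by
  rw [ENNReal.ofReal_pow (norm_nonneg _), ofReal_norm]

variable {ι : Type*} [Fintype ι] {m : ι → ℤ} {a : ι → ℂ}

theorem continuous_enorm_expSum_sq : Continuous fun t => ‖expSum m a t‖ₑ ^ 2 :=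
  (ENNReal.continuous_pow 2).comp continuous_expSum.enorm

theorem measurable_lintegral_Ioo_enorm_expSum_sub_sq (x y : ℝ) :
    Measurable fun s : ℝ => ∫⁻ t in Ioo x y, ‖expSum m a (s - t)‖ₑ ^ 2 :=
  Measurable.lintegral_prod_right' (f := fun z : ℝ × ℝ => ‖expSum m a (z.1 - z.2)‖ₑ ^ 2)
    (continuous_enorm_expSum_sq.measurable.comp (measurable_fst.sub measurable_snd))

theorem lintegral_enorm_expSum_sq (hm : Function.Injective m) (a : ι → ℂ) :
    ∫⁻ t in Ico (0 : ℝ) 1, ‖expSum m a t‖ₑ ^ 2 = ∑ i, ‖a i‖ₑ ^ 2 := by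
  have hint : IntegrableOn (fun t => ‖expSum m a t‖ ^ 2) (Ico 0 1) :=
    (Continuous.integrableOn_Icc (by fun_prop)).mono_set Ico_subset_Icc_self
  simp_rw [← ofReal_norm_sq]
  rw [← ofReal_integral_eq_lintegral_ofReal hint (.of_forall fun t => by positivity),
    integral_Ico_eq_integral_Ioc, ← intervalIntegral.integral_of_le zero_le_one,
    integral_norm_expSum_sq hm, ENNReal.ofReal_sum_of_nonneg fun i _ => by positivity]

theorem expSum_mul_fourierChar (a : ι → ℂ) (x y : ℝ) :
    expSum m (fun i => a i * 𝐞 (m i * x)) y = expSum m a (x + y) := by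
  simp_rw [expSum, mul_add, coe_fourierChar_add, mul_assoc]

theorem sum_mul_expSum_sub_mul {N : ℕ} (q : Fin N → ℂ) (a : ι → ℂ) (η s : ℝ) :
    ∑ j, q j * expSum m a (s - j * η) =
      expSum m (fun i => expSum (fun j : Fin N => (j : ℤ)) q (-(m i * η)) * a i) s := by
  simp_rw [expSum, Finset.mul_sum, Finset.sum_mul]
  rw [Finset.sum_comm]
  refine Finset.sum_congr rfl fun i _ => Finset.sum_congr rfl fun j _ => ?_
  have harg : (m i * (s - j * η) : ℝ) = (j : ℤ) * -(m i * η) + m i * s := by push_cast; ring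
  rw [harg, coe_fourierChar_add]
  ring

theorem exists_one_le_norm_expSum_of_mem_window {N : ℕ} (hN : 2 ≤ N) {b L η : ℝ} (hL : 0 ≤ L)
    (hη : 0 ≤ η) (hLη : L * η ≤ 1) : ∃ q : Fin N → ℂ,
      (∀ y ∈ Icc b (b + L), 1 ≤ ‖expSum (fun j : Fin N => (j : ℤ)) q (-(y * η))‖) ∧
        ∑ j, ‖q j‖ ^ 2 = L * η + 1 / N := by
  obtain ⟨q, hq, hsum⟩ := exists_one_le_norm_expSum_of_mem_Icc hN ⟨mul_nonneg hL hη, hLη⟩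
  refine ⟨fun j => q j * 𝐞 ((j : ℤ) * ((b + L) * η)), fun y hy => ?_, ?_⟩
  · rw [expSum_mul_fourierChar]
    refine hq _ ⟨?_, ?_⟩ <;> nlinarith [hy.1, hy.2]
  · simpa only [norm_mul, Circle.norm_coe, mul_one] using hsum

/-- Dividing `a i` by a multiplier `∑ j, q j e^{-2πi j m i η}` of modulus at least one shrinks the
coefficients and writes the exponential sum as a combination of translates by multiples of `η`. -/
theorem exists_norm_expSum_sq_le_mul_sum_translates {N : ℕ} (hN : 2 ≤ N) {b L η : ℝ} (hL : 0 ≤ L)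
    (hm : ∀ i, (m i : ℝ) ∈ Icc b (b + L)) (hη : 0 ≤ η) (hLη : L * η ≤ 1) :
    ∃ c : ι → ℂ, (∀ i, ‖c i‖ ≤ ‖a i‖) ∧ ∀ s, ‖expSum m a s‖ ^ 2 ≤
      (L * η + 1 / N) * ∑ j ∈ Finset.range N, ‖expSum m c (s - j * η)‖ ^ 2 := by
  obtain ⟨q, hq, hsum⟩ := exists_one_le_norm_expSum_of_mem_window hN (b := b) hL hη hLη
  set Q : ι → ℂ := fun i => expSum (fun j : Fin N => (j : ℤ)) q (-(m i * η))
  have hQ1 (i : ι) : 1 ≤ ‖Q i‖ := hq _ (hm i)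
  have hQ0 (i : ι) : Q i ≠ 0 := norm_pos_iff.1 (one_pos.trans_le (hQ1 i))
  refine ⟨fun i => a i / Q i, fun i => ?_, fun s => ?_⟩
  · rw [norm_div]
    exact div_le_self (norm_nonneg _) (hQ1 i)
  have hcomb : ∑ j, q j * expSum m (fun i => a i / Q i) (s - j * η) = expSum m a s := by
    rw [sum_mul_expSum_sub_mul]
    congr 1
    exact funext fun i => mul_div_cancel₀ _ (hQ0 i)
  rw [← hcomb, ← hsum,
    ← Fin.sum_univ_eq_sum_range fun j => ‖expSum m (fun i => a i / Q i) (s - j * η)‖ ^ 2]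
  calc ‖∑ j, q j * expSum m (fun i => a i / Q i) (s - j * η)‖ ^ 2
      ≤ (∑ j, ‖q j‖ * ‖expSum m (fun i => a i / Q i) (s - j * η)‖) ^ 2 := by
        gcongr
        exact (norm_sum_le _ _).trans_eq (by simp_rw [norm_mul])
    _ ≤ _ := Finset.sum_mul_sq_le_sq_mul_sq _ _ _

theorem exists_enorm_expSum_sq_le_mul_sum_translates {N : ℕ} (hN : 2 ≤ N) {b L η : ℝ} (hL : 0 ≤ L)
    (hm : ∀ i, (m i : ℝ) ∈ Icc b (b + L)) (hη : 0 ≤ η) (hLη : L * η ≤ 1) :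
    ∃ c : ι → ℂ, (∀ i, ‖c i‖ₑ ≤ ‖a i‖ₑ) ∧ ∀ s, ‖expSum m a s‖ₑ ^ 2 ≤
      ENNReal.ofReal (L * η + 1 / N) *
        ∑ j ∈ Finset.range N, ‖expSum m c (s - j * η)‖ₑ ^ 2 := by
  obtain ⟨c, hc, hle⟩ := exists_norm_expSum_sq_le_mul_sum_translates (a := a) hN hL hm hη hLη
  refine ⟨c, fun i => enorm_le_iff_norm_le.2 (hc i), fun s => ?_⟩
  simp_rw [← ofReal_norm_sq]
  rw [← ENNReal.ofReal_sum_of_nonneg fun j _ => by positivity, ← ENNReal.ofReal_mul (by positivity)]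
  exact ENNReal.ofReal_le_ofReal (hle s)

theorem sum_lintegral_Ioo_translate_le (f : ℝ → ℝ≥0∞) (N : ℕ) {η : ℝ} (hη : 0 ≤ η) :
    ∑ j ∈ Finset.range N, ∫⁻ t in Ioo 0 η, f (t + j * η) ≤ ∫⁻ t in Ioo 0 (N * η), f t := by
  have hmono : Monotone fun j : ℕ => (j : ℝ) * η := fun i j hij =>
    mul_le_mul_of_nonneg_right (Nat.cast_le.2 hij) hη
  have hdisj : Pairwise (Function.onFun Disjoint fun j : ℕ => Ioo (j * η) ((j + 1 : ℕ) * η)) :=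
    hmono.pairwise_disjoint_on_Ioo_succ
  have htranslate (j : ℕ) : ∫⁻ t in Ioo 0 η, f (t + j * η) =
      ∫⁻ t in Ioo (j * η) ((j + 1 : ℕ) * η), f t := by
    rw [(measurePreserving_add_right volume (j * η)).setLIntegral_comp_emb
      (measurableEmbedding_addRight _), image_add_const_Ioo, zero_add]
    push_cast
    ring_nf
  simp_rw [htranslate]
  rw [← lintegral_biUnion_finset (hdisj.set_pairwise _) fun _ _ => measurableSet_Ioo]
  refine lintegral_mono_set (iUnion₂_subset fun j hj => Ioo_subset_Ioo (by positivity) ?_)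
  exact hmono (Finset.mem_range.1 hj)

theorem le_liminf_average {f : ℝ → ℝ≥0∞} (hf : Continuous f) {δ : ℝ} (hδ : 0 < δ) (s : ℝ) :
    f s ≤ liminf (fun N : ℕ => ENNReal.ofReal (N / δ) * ∫⁻ t in Ioo 0 (δ / N), f (s - t))
      atTop := by
  refine le_of_forall_lt fun b hb => ?_
  obtain ⟨b', hbb', hb'⟩ := exists_between hb
  refine hbb'.trans_le (le_liminf_of_le (by isBoundedDefault) ?_)
  have hnear : ∀ᶠ t in 𝓝 (0 : ℝ), b' < f (s - t) := by
    have hcont : Continuous fun t => f (s - t) := by fun_prop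
    exact (hcont.tendsto 0).eventually (Ioi_mem_nhds (by simpa using hb'))
  obtain ⟨ε, hε, hball⟩ := Metric.eventually_nhds_iff.1 hnear
  have hsmall := (tendsto_const_div_atTop_nhds_zero_nat δ).eventually (Iio_mem_nhds hε)
  filter_upwards [hsmall, eventually_gt_atTop 0] with N hNε hN
  have hN : (0 : ℝ) < N := by exact_mod_cast hN
  calc b' = ENNReal.ofReal (N / δ) * ∫⁻ _ in Ioo 0 (δ / N), b' := by
        rw [setLIntegral_const, Real.volume_Ioo, sub_zero, mul_left_comm,
          ← ENNReal.ofReal_mul (by positivity), div_mul_div_cancel₀ hδ.ne', div_self hN.ne',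
          ENNReal.ofReal_one, mul_one]
    _ ≤ ENNReal.ofReal (N / δ) * ∫⁻ t in Ioo 0 (δ / N), f (s - t) := by
        refine mul_le_mul' le_rfl (setLIntegral_mono' measurableSet_Ioo fun t ht => (hball ?_).le)
        rw [Real.dist_eq, sub_zero, abs_of_pos ht.1]
        exact ht.2.trans hNε

theorem exists_average_enorm_expSum_sq_le {N : ℕ} (hN : 2 ≤ N) {b L δ : ℝ} (hL : 0 ≤ L)
    (hm : ∀ i, (m i : ℝ) ∈ Icc b (b + L)) (hδ : 0 < δ) (hLδ : L * δ ≤ N) :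
    ∃ c : ι → ℂ, (∀ i, ‖c i‖ₑ ≤ ‖a i‖ₑ) ∧ ∀ s,
      ENNReal.ofReal (N / δ) * ∫⁻ t in Ioo 0 (δ / N), ‖expSum m a (s - t)‖ₑ ^ 2 ≤
        ENNReal.ofReal (L + 1 / δ) * ∫⁻ t in Ioo 0 δ, ‖expSum m c (s - t)‖ₑ ^ 2 := by
  have hN0 : (0 : ℝ) < N := by positivity
  obtain ⟨c, hc, hle⟩ := exists_enorm_expSum_sq_le_mul_sum_translates (a := a) hN hL hm
    (η := δ / N) (by positivity) (by rwa [mul_div_assoc', div_le_one hN0])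
  refine ⟨c, hc, fun s => ?_⟩
  have hmeas (y : ℝ) : Measurable fun t : ℝ => ‖expSum m c (s - t - y)‖ₑ ^ 2 :=
    continuous_enorm_expSum_sq.measurable.comp (by fun_prop)
  have hconst : ENNReal.ofReal (N / δ) * ENNReal.ofReal (L * (δ / N) + 1 / N) =
      ENNReal.ofReal (L + 1 / δ) := by
    rw [← ENNReal.ofReal_mul (by positivity)]
    congr 1
    field_simp
  calc ENNReal.ofReal (N / δ) * ∫⁻ t in Ioo 0 (δ / N), ‖expSum m a (s - t)‖ₑ ^ 2
      ≤ ENNReal.ofReal (N / δ) * ∫⁻ t in Ioo 0 (δ / N), ENNReal.ofReal (L * (δ / N) + 1 / N) *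
          ∑ j ∈ Finset.range N, ‖expSum m c (s - t - j * (δ / N))‖ₑ ^ 2 := by
        gcongr
        exact hle _
    _ = ENNReal.ofReal (L + 1 / δ) * ∑ j ∈ Finset.range N,
          ∫⁻ t in Ioo 0 (δ / N), ‖expSum m c (s - (t + j * (δ / N)))‖ₑ ^ 2 := by
        rw [lintegral_const_mul _ (Finset.measurable_fun_sum _ fun j _ => hmeas _),
          lintegral_finsetSum _ fun j _ => hmeas _, ← mul_assoc, hconst]
        simp_rw [sub_sub]
    _ ≤ ENNReal.ofReal (L + 1 / δ) * ∫⁻ t in Ioo 0 δ, ‖expSum m c (s - t)‖ₑ ^ 2 := by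
        gcongr
        refine (sum_lintegral_Ioo_translate_le (fun t => ‖expSum m c (s - t)‖ₑ ^ 2) N
          (by positivity)).trans_eq ?_
        rw [mul_div_cancel₀ _ hN0.ne']

theorem lintegral_average_enorm_expSum_sq_le {μ : Measure ℝ} [SFinite μ]
    (hμ : IsOnePeriodicMeasure μ) {N : ℕ} (hN : 2 ≤ N) (hinj : Function.Injective m) {b L δ : ℝ}
    (hL : 0 ≤ L) (hm : ∀ i, (m i : ℝ) ∈ Icc b (b + L)) (hδ : 0 < δ) (hLδ : L * δ ≤ N) :
    ∫⁻ s in Ico (0 : ℝ) 1, ENNReal.ofReal (N / δ) *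
        (∫⁻ t in Ioo 0 (δ / N), ‖expSum m a (s - t)‖ₑ ^ 2) ∂μ ≤
      ENNReal.ofReal (L + 1 / δ) * (⨆ r ∈ Ico (0 : ℝ) 1, μ (Ioo r (r + δ))) *
        ∑ i, ‖a i‖ₑ ^ 2 := by
  obtain ⟨c, hc, hle⟩ := exists_average_enorm_expSum_sq_le (a := a) hN hL hm hδ hLδ
  have hper : Function.Periodic (fun t => ‖expSum m c t‖ₑ ^ 2) 1 := fun t => by
    simp only [periodic_expSum t]
  calc _ ≤ ∫⁻ s in Ico (0 : ℝ) 1, ENNReal.ofReal (L + 1 / δ) *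
          (∫⁻ t in Ioo 0 δ, ‖expSum m c (s - t)‖ₑ ^ 2) ∂μ := lintegral_mono hle
    _ ≤ ENNReal.ofReal (L + 1 / δ) * ((⨆ r ∈ Ico (0 : ℝ) 1, μ (Ioo r (r + δ))) *
          ∫⁻ t in Ico (0 : ℝ) 1, ‖expSum m c t‖ₑ ^ 2) := by
        rw [lintegral_const_mul _ (measurable_lintegral_Ioo_enorm_expSum_sub_sq _ _)]
        gcongr
        exact hμ.lintegral_Ico_lintegral_Ioo_sub_le continuous_enorm_expSum_sq.measurable hper δ
    _ ≤ _ := by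
        rw [lintegral_enorm_expSum_sq hinj, ← mul_assoc]
        gcongr with i
        exact hc i

theorem lintegral_enorm_expSum_sq_le {μ : Measure ℝ} [SFinite μ] (hμ : IsOnePeriodicMeasure μ)
    (hinj : Function.Injective m) {b L δ : ℝ} (hL : 0 ≤ L)
    (hm : ∀ i, (m i : ℝ) ∈ Icc b (b + L)) (hδ : 0 < δ) :
    ∫⁻ s in Ico (0 : ℝ) 1, ‖expSum m a s‖ₑ ^ 2 ∂μ ≤
      ENNReal.ofReal (L + 1 / δ) * (⨆ r ∈ Ico (0 : ℝ) 1, μ (Ioo r (r + δ))) *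
        ∑ i, ‖a i‖ₑ ^ 2 := by
  refine (lintegral_mono fun s => le_liminf_average continuous_enorm_expSum_sq hδ s).trans ?_
  refine (lintegral_liminf_le fun N =>
    (measurable_lintegral_Ioo_enorm_expSum_sub_sq _ _).const_mul _).trans
      (liminf_le_of_frequently_le' (Eventually.frequently ?_))
  filter_upwards [eventually_ge_atTop ⌈L * δ⌉₊, eventually_ge_atTop 2] with N hLδ hN
  exact lintegral_average_enorm_expSum_sq_le hμ hN hinj hL hm hδ (Nat.ceil_le.1 hLδ)

theorem enorm_trigPoly {n : ℕ} (φ : ℝ) (a : EuclideanSpace ℂ (Fin n)) (s : ℝ) :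
    ‖trigPoly φ a s‖ₑ = ‖expSum (fun k : Fin n => -((k : ℤ) + 1)) a s‖ₑ := by
  have hexp (x : ℝ) : (𝐞 x : ℂ) = Complex.exp (2 * Real.pi * Complex.I * x) := by
    rw [Real.fourierChar_apply]; congr 1; push_cast; ring
  have h : trigPoly φ a s = 𝐞 φ * expSum (fun k : Fin n => -((k : ℤ) + 1)) a s := by
    rw [trigPoly, expSum, hexp]
    congr 1
    refine Finset.sum_congr rfl fun k _ => ?_
    rw [hexp]
    congr 2
    push_cast
    ring
  rw [h, enorm_mul, ← ofReal_norm, Circle.norm_coe, ENNReal.ofReal_one, one_mul]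

theorem lintegral_enorm_trigPoly_sq_le {μ : Measure ℝ} [SFinite μ] (hμ : IsOnePeriodicMeasure μ)
    {n : ℕ} (φ : ℝ) (a : EuclideanSpace ℂ (Fin n)) {δ : ℝ} (hδ : 0 < δ) :
    ∫⁻ s in Ico (0 : ℝ) 1, ‖trigPoly φ a s‖ₑ ^ 2 ∂μ ≤
      ENNReal.ofReal ((n : ℝ) - 1 + 1 / δ) *
        (⨆ r ∈ Ico (0 : ℝ) 1, μ (Ioo r (r + δ))) * ‖a‖ₑ ^ 2 := by
  rcases n.eq_zero_or_pos with rfl | hn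
  · simp [trigPoly]
  have hn : (1 : ℝ) ≤ n := by exact_mod_cast hn
  have hinj : Function.Injective fun k : Fin n => -((k : ℤ) + 1) := fun k l h => by
    simpa [Fin.ext_iff] using h
  have hwindow (k : Fin n) : ((-((k : ℤ) + 1) : ℤ) : ℝ) ∈ Icc (-n : ℝ) (-n + (n - 1)) := by
    have hk : (k : ℝ) + 1 ≤ n := by exact_mod_cast k.2
    push_cast
    constructor <;> linarith [(k : ℕ).cast_nonneg (α := ℝ)]
  have ha : ‖a‖ₑ ^ 2 = ∑ k, ‖a k‖ₑ ^ 2 := by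
    rw [← ofReal_norm_sq, EuclideanSpace.norm_sq_eq,
      ENNReal.ofReal_sum_of_nonneg fun i _ => by positivity]
    simp_rw [ofReal_norm_sq]
  simp_rw [enorm_trigPoly, ha]
  exact lintegral_enorm_expSum_sq_le hμ hinj (sub_nonneg.2 hn) hwindow hδ

end LargeSieve

theorem mainTheorem4_general (μ : Measure ℝ) (hμ : IsOnePeriodicMeasure μ)
    (n : ℕ) (φ : ℝ) (a : EuclideanSpace ℂ (Fin n)) (δ : ℝ) (hδ : 0 < δ) :
    ∫⁻ s in Set.Ico (0 : ℝ) 1, ‖trigPoly φ a s‖ₑ ^ 2 ∂μ ≤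
      ENNReal.ofReal ((n : ℝ) - 1 + 1 / δ) *
        (⨆ r ∈ Set.Ico (0 : ℝ) 1, μ (Set.Ioo r (r + δ))) * ‖a‖ₑ ^ 2 := by
  by_cases hfin : (⨆ r ∈ Set.Ico (0 : ℝ) 1, μ (Set.Ioo r (r + δ))) = ⊤
  · rcases eq_or_ne a 0 with rfl | ha
    · simp [trigPoly]
    · have hn : (1 : ℝ) ≤ n := by
        have : n ≠ 0 := by rintro rfl; exact ha (Subsingleton.elim _ _)
        exact_mod_cast Nat.one_le_iff_ne_zero.2 this
      have hpos : 0 < (n : ℝ) - 1 + 1 / δ := by have := one_div_pos.2 hδ; linarith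
      rw [hfin, ENNReal.mul_top (ENNReal.ofReal_pos.2 hpos).ne',
        ENNReal.top_mul (pow_ne_zero 2 (enorm_ne_zero.2 ha))]
      exact le_top
  · have := hμ.isLocallyFiniteMeasure hδ hfin
    exact lintegral_enorm_trigPoly_sq_le hμ φ a hδ

theorem mainTheorem4 (μ : Measure ℝ) [SigmaFinite μ] (hμ : IsOnePeriodicMeasure μ)
    (n : ℕ) (φ : ℝ) (hφ : φ ∈ Set.Ico (0 : ℝ) 1) (a : EuclideanSpace ℂ (Fin n))
    (δ : ℝ) (hδ : δ ∈ Set.Ioc (0 : ℝ) 1) :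
    ∫⁻ s in Set.Ico (0 : ℝ) 1, ‖trigPoly φ a s‖ₑ ^ 2 ∂μ ≤
      ENNReal.ofReal ((n : ℝ) - 1 + 1 / δ) *
        (⨆ r ∈ Set.Ico (0 : ℝ) 1, μ (Set.Ioo r (r + δ))) * ‖a‖ₑ ^ 2 :=
  mainTheorem4_general μ hμ n φ a δ hδ.1
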